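/- Let $F$ be a field, $R=F[x_1,\ldots,x_n]$, and fix an admissible term ordering $\prec$ on the terms (monomials with coefficient $1$) of $R$; write $\mathrm{lt}(p)$ and $\mathrm{lc}(p)$ for the leading term and leading coefficient of a nonzero $p\in R$. For nonzero $f,g\in R$ let $$S(f,g)=\mathrm{lc}(g)\,\frac{\mathrm{lcm}(\mathrm{lt}(f),\mathrm{lt}(g))}{\mathrm{lt}(f)}\,f-\mathrm{lc}(f)\,\frac{\mathrm{lcm}(\mathrm{lt}(f),\mathrm{lt}(g))}{\mathrm{lt}(g)}\,g .$$ Terms $(t_1,\ldots,t_m)$ satisfy the Extended Criterion if $\gcd(t_1,t_m)$ divides $t_k$ for every $1\le k\le m$, and for every variable $x$ either $\deg_x\gcd(t_1,t_m)=0$ or the sequence $(\deg_x t_k)_{k=1}^m$ is monotonic (nondecreasing or nonincreasing). Let $G=(g_1,\ldots,g_m)\in R^m$ with $m\ge 1$ and all $g_i\neq 0$. We say that $S(g_i,g_j)$ has an $S$-representation with respect to $G$ if there are a term $t\prec\mathrm{lcm}(\mathrm{lt}(g_i),\mathrm{lt}(g_j))$ and $h_1,\ldots,h_m\in R$ such that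 $S(g_i,g_j)=h_1g_1+\cdots+h_mg_m$ and, for each $k$, $h_k=0$ or $\mathrm{lt}(h_kg_k)\preceq t$. **Theorem.** Suppose that $g_1$ and $g_m$ are not both constants and that $(\mathrm{lt}(g_1),\ldots,\mathrm{lt}(g_m))$ satisfies the Extended Criterion. If each of $S(g_1,g_2),S(g_2,g_3),\ldots,S(g_{m-1},g_m)$ has an $S$-representation with respect to $G$, then $S(g_1,g_m)$ also has an $S$-representation with respect to $G$. -/

import Mathlib

/-! A term `x₁^{a₁} ⋯ xₙ^{aₙ}` is represented by its exponent vector `a : Fin n →₀ ℕ`.  Then `⊓` is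
the gcd, `⊔` the lcm and `≤` the divisibility of terms, `a x` is the degree of `a` in the variable
`x`, and `0` is the term `1`.  An admissible term ordering is a `MonomialOrder (Fin n)`: the term
`s` is smaller than `t` when `ord.toSyn s < ord.toSyn t`.  The leading term of a nonzero
polynomial `p` is `ord.degree p`, and the S-polynomial of `f` and `g` is `ord.sPolynomial f g`,
that is `lc(g) (lcm(lt f, lt g)/lt f) f - lc(f) (lcm(lt f, lt g)/lt g) g`. -/

/-- The Extended Criterion for a nonempty list of terms, indexed by `0, …, m`. -/
structure ExtendedCriterion {n m : ℕ} (t : Fin (m + 1) → (Fin n →₀ ℕ)) : Prop where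
  /-- The gcd of the first and the last term divides every term of the list. -/
  ediv : ∀ k, t 0 ⊓ t (Fin.last m) ≤ t k
  /-- For each variable, either it does not occur in the gcd of the first and the last term, or
  the sequence of its degrees is monotonic (in one direction or the other). -/
  evar : ∀ x : Fin n, (t 0 ⊓ t (Fin.last m)) x = 0 ∨
    Monotone (fun k => t k x) ∨ Antitone (fun k => t k x)

/-- `h` is a `t`-representation of `p` with respect to `G`. -/
def IsTRepresentation {n m : ℕ} {F : Type*} [Field F] (ord : MonomialOrder (Fin n))
    (G : Fin m → MvPolynomial (Fin n) F) (p : MvPolynomial (Fin n) F) (t : Fin n →₀ ℕ)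
    (h : Fin m → MvPolynomial (Fin n) F) : Prop :=
  p = ∑ i, h i * G i ∧
    ∀ i, h i = 0 ∨ ord.toSyn (ord.degree (h i * G i)) ≤ ord.toSyn t

/-- `S(gᵢ, gⱼ)` has an S-representation with respect to `G`: a `t`-representation for some term
`t` that is smaller than the lcm of the leading terms of `gᵢ` and `gⱼ`. -/
def HasSRepresentation {n m : ℕ} {F : Type*} [Field F] (ord : MonomialOrder (Fin n))
    (G : Fin m → MvPolynomial (Fin n) F) (i j : Fin m) : Prop :=
  ∃ (t : Fin n →₀ ℕ) (h : Fin m → MvPolynomial (Fin n) F),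
    ord.toSyn t < ord.toSyn (ord.degree (G i) ⊔ ord.degree (G j)) ∧
      IsTRepresentation ord G (ord.sPolynomial (G i) (G j)) t h

open MvPolynomial

namespace MonomialOrder

variable {σ R : Type*} [CommRing R] (ord : MonomialOrder σ)

/-! Each S-representation is a syzygy of `G` whose top terms sit only at two consecutive positions.
The resulting `m × (m + 1)` matrix of syzygies has maximal minors proportional to `G`, up to sign:
`D 0 * G (Fin.last m) = ± D (Fin.last m) * G 0`. So the cofactors `c`, `d` of `G 0`, `G (Fin.last
m)` over their gcd divide `D 0`, `D (Fin.last m)`.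

The top coefficients of these two minors form triangular matrices, so their leading terms are the
product of the consecutive lcms over the product of the remaining leading terms (`degree_det_eq`).
Where the degrees in `x` are monotonic, this quotient telescopes and one minor has `x`-degree `0`.
Hence `c` and `d` have coprime leading terms, and Buchberger's product criterion applies. -/

theorem coeff_prod_of_degree_le {ι : Type*} (s : Finset ι) {f : ι → MvPolynomial σ R}
    {a : ι → σ →₀ ℕ} (h : ∀ i ∈ s, ord.toSyn (ord.degree (f i)) ≤ ord.toSyn (a i)) :
    (∏ i ∈ s, f i).coeff (∑ i ∈ s, a i) = ∏ i ∈ s, (f i).coeff (a i) := by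
  classical
  induction s using Finset.induction_on with
  | empty => simp
  | insert i s hi ih =>
    rw [Finset.prod_insert hi, Finset.sum_insert hi, Finset.prod_insert hi,
      coeff_mul_of_add_of_degree_le (h i (Finset.mem_insert_self i s)),
      ih fun j hj => h j (Finset.mem_insert_of_mem hj)]
    refine degree_prod_le.trans ?_
    rw [map_sum, map_sum]
    exact Finset.sum_le_sum fun j hj => h j (Finset.mem_insert_of_mem hj)

section Det

variable {ι : Type*} [Fintype ι] [DecidableEq ι]

/-- Every Leibniz product takes one entry from each row, so it reaches the total bound only through
the coefficients at the row bounds. -/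
theorem coeff_det_of_degree_le {M : Matrix ι ι (MvPolynomial σ R)} {a : ι → σ →₀ ℕ}
    (h : ∀ i j, ord.toSyn (ord.degree (M i j)) ≤ ord.toSyn (a i)) :
    M.det.coeff (∑ i, a i) = (Matrix.of fun i j => (M i j).coeff (a i)).det := by
  rw [Matrix.det_apply, Matrix.det_apply, coeff_sum]
  refine Finset.sum_congr rfl fun τ _ => ?_
  rw [← Equiv.sum_comp τ a, Units.smul_def, Units.smul_def, coeff_smul,
    ord.coeff_prod_of_degree_le _ fun i _ => h (τ i) i]
  rfl

theorem degree_det_le {M : Matrix ι ι (MvPolynomial σ R)} {a : ι → σ →₀ ℕ}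
    (h : ∀ i j, ord.toSyn (ord.degree (M i j)) ≤ ord.toSyn (a i)) :
    ord.toSyn (ord.degree M.det) ≤ ord.toSyn (∑ i, a i) := by
  rw [Matrix.det_apply]
  refine degree_sum_le.trans (Finset.sup_le fun τ _ => ?_)
  have hp : ord.toSyn (ord.degree (∏ i, M (τ i) i)) ≤ ord.toSyn (∑ i, a i) := by
    refine degree_prod_le.trans ?_
    rw [← Equiv.sum_comp τ a, map_sum, map_sum]
    exact Finset.sum_le_sum fun i _ => h (τ i) i
  obtain hs | hs := Int.units_eq_one_or (Equiv.Perm.sign τ) <;> simpa [hs] using hp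

/-- If the coefficients of the rows of `M` at their degree bounds form a nonsingular matrix, then
the degree of the determinant is the sum of the bounds. -/
theorem degree_det_eq {M : Matrix ι ι (MvPolynomial σ R)} {a : ι → σ →₀ ℕ}
    (h : ∀ i j, ord.toSyn (ord.degree (M i j)) ≤ ord.toSyn (a i))
    (hdet : (Matrix.of fun i j => (M i j).coeff (a i)).det ≠ 0) :
    M.det ≠ 0 ∧ ord.degree M.det = ∑ i, a i := by
  have hc : M.det.coeff (∑ i, a i) ≠ 0 := by rwa [ord.coeff_det_of_degree_le h]
  refine ⟨fun h0 => hc (by simp [h0]), ord.toSyn.injective (le_antisymm (ord.degree_det_le h) ?_)⟩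
  exact ord.le_degree (mem_support_iff.mpr hc)

end Det

end MonomialOrder

open MonomialOrder

section SRepresentation

variable {n m : ℕ} {F : Type*} [Field F] (ord : MonomialOrder (Fin n))

/-- Buchberger's product criterion, for polynomials whose cofactors with respect to a common
divisor have coprime leading terms. -/
theorem hasSRepresentation_of_inf_degree_eq_zero (G : Fin m → MvPolynomial (Fin n) F)
    {i j : Fin m} (hij : i ≠ j) (hi : G i ≠ 0) (hj : G j ≠ 0)
    (hne : ord.degree (G i) ≠ 0 ∨ ord.degree (G j) ≠ 0)
    {p c d : MvPolynomial (Fin n) F} (hc : p * c = G i) (hd : p * d = G j)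
    (hcd : ord.degree c ⊓ ord.degree d = 0) : HasSRepresentation ord G i j := by
  have hp0 : p ≠ 0 := left_ne_zero_of_mul (hc ▸ hi)
  have hc0 : c ≠ 0 := right_ne_zero_of_mul (hc ▸ hi)
  have hd0 : d ≠ 0 := right_ne_zero_of_mul (hd ▸ hj)
  have hdi : ord.degree (G i) = ord.degree p + ord.degree c := by rw [← hc, degree_mul hp0 hc0]
  have hdj : ord.degree (G j) = ord.degree p + ord.degree d := by rw [← hd, degree_mul hp0 hd0]
  have hmin (x : Fin n) : min (ord.degree c x) (ord.degree d x) = 0 := DFunLike.congr_fun hcd x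
  have hlcm : ord.degree (G i) ⊔ ord.degree (G j)
      = ord.degree p + ord.degree c + ord.degree d := by
    ext x
    have := hmin x
    simp only [hdi, hdj, Finsupp.sup_apply, Finsupp.add_apply]
    omega
  have hsubi : ord.degree (G j) - ord.degree (G i) = ord.degree d := by
    ext x
    have := hmin x
    simp only [hdi, hdj, Finsupp.tsub_apply, Finsupp.add_apply]
    omega
  have hsubj : ord.degree (G i) - ord.degree (G j) = ord.degree c := by
    ext x
    have := hmin x
    simp only [hdi, hdj, Finsupp.tsub_apply, Finsupp.add_apply]
    omega
  -- Since `d * G i = c * G j`, the leading terms of `d` and `c` in the S-polynomial can be traded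
  -- for minus their tails.
  set a := C (-ord.leadingCoeff p) * (d - ord.leadingTerm d) with ha
  set b := C (ord.leadingCoeff p) * (c - ord.leadingTerm c) with hb
  -- Needed when a tail vanishes, as the zero polynomial has degree `0`.
  have hpos : ord.toSyn 0 < ord.toSyn (ord.degree (G i) ⊔ ord.degree (G j)) := by
    rw [map_zero, ord.toSyn_lt_iff_ne_zero, ne_eq, EmbeddingLike.map_eq_zero_iff]
    intro h0
    have hle0 : ord.degree (G i) ≤ 0 ∧ ord.degree (G j) ≤ 0 := sup_le_iff.mp h0.le
    exact hne.elim (fun h => h (nonpos_iff_eq_zero.mp hle0.1))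
      fun h => h (nonpos_iff_eq_zero.mp hle0.2)
  have key (u v w : MvPolynomial (Fin n) F) (r : F) (hw : w ≠ 0) (hv : v ≠ 0)
      (hu : ord.degree v + ord.degree w = ord.degree (G i) ⊔ ord.degree (G j))
      (huv : u = C r * (v - ord.leadingTerm v)) :
      ord.toSyn (ord.degree (u * w)) < ord.toSyn (ord.degree (G i) ⊔ ord.degree (G j)) := by
    by_cases h0 : v - ord.leadingTerm v = 0
    · simpa [huv, h0] using hpos
    · have h1 := ord.degree_sub_leadingTerm_lt_degree (degree_ne_zero_of_sub_leadingTerm_ne_zero h0)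
      refine lt_of_le_of_lt degree_mul_le ?_
      rw [← hu, map_add, map_add]
      refine add_lt_add_left (lt_of_le_of_lt ?_ h1) _
      rw [huv]
      refine degree_mul_le.trans ?_
      simp
  have hai := key a d (G i) _ hi hd0 (by rw [hlcm, hdi]; abel) ha
  have hbj := key b c (G j) _ hj hc0 (by rw [hlcm, hdj]; abel) hb
  obtain ⟨t, ht, hat, hbt⟩ : ∃ t, ord.toSyn t < ord.toSyn (ord.degree (G i) ⊔ ord.degree (G j)) ∧
      ord.toSyn (ord.degree (a * G i)) ≤ ord.toSyn t ∧
      ord.toSyn (ord.degree (b * G j)) ≤ ord.toSyn t := by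
    obtain h | h := le_total (ord.toSyn (ord.degree (a * G i))) (ord.toSyn (ord.degree (b * G j)))
    · exact ⟨_, hbj, h, le_rfl⟩
    · exact ⟨_, hai, le_rfl, h⟩
  refine ⟨t, fun k => if k = i then a else if k = j then b else 0, ht, ?_, fun k => ?_⟩
  · have hsum : ∑ k, (if k = i then a else if k = j then b else 0) * G k = a * G i + b * G j := by
      have (k : Fin m) : (if k = i then a else if k = j then b else 0) * G k =
          (if k = i then a * G i else 0) + (if k = j then b * G j else 0) := by
        by_cases h1 : k = i
        · subst h1; simp [hij]
        · by_cases h2 : k = j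
          · subst h2; simp [h1]
          · simp [h1, h2]
      simp [this, Finset.sum_add_distrib]
    have hlt (q : MvPolynomial (Fin n) F) : monomial (ord.degree q)
        (ord.leadingCoeff p * ord.leadingCoeff q) = C (ord.leadingCoeff p) * ord.leadingTerm q := by
      rw [leadingTerm, C_mul_monomial]
    rw [hsum, sPolynomial, hsubi, hsubj, ← hd, leadingCoeff_mul, ← hc, leadingCoeff_mul, hlt, hlt,
      ha, hb, map_neg]
    ring
  · by_cases h1 : k = i
    · subst h1; simpa using Or.inr hat
    · by_cases h2 : k = j
      · subst h2; simpa [h1] using Or.inr hbt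
      · simp [h1, h2]

/-- An S-representation of `S(gᵢ, gⱼ)` is a syzygy: its terms `yₖ gₖ` are
bounded by the lcm, which occurs only in the `i`-th and the `j`-th of them. -/
theorem HasSRepresentation.exists_syzygy {G : Fin m → MvPolynomial (Fin n) F} {i j : Fin m}
    (hij : i ≠ j) (hi : G i ≠ 0) (hj : G j ≠ 0) (h : HasSRepresentation ord G i j) :
    ∃ y : Fin m → MvPolynomial (Fin n) F, ∑ k, y k * G k = 0 ∧
      (∀ k, ord.toSyn (ord.degree (y k * G k)) ≤
        ord.toSyn (ord.degree (G i) ⊔ ord.degree (G j))) ∧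
      (∀ k, (y k * G k).coeff (ord.degree (G i) ⊔ ord.degree (G j)) ≠ 0 ↔ k = i ∨ k = j) := by
  obtain ⟨t, h, ht, hsum, hle⟩ := h
  set L := ord.degree (G i) ⊔ ord.degree (G j) with hL
  have hlt (k) : ord.toSyn (ord.degree (h k * G k)) < ord.toSyn L ∨ h k * G k = 0 := by
    obtain h0 | h0 := hle k
    · exact Or.inr (by simp [h0])
    · exact Or.inl (h0.trans_lt ht)
  have hcoeff (k) : (h k * G k).coeff L = 0 := by
    obtain h0 | h0 := hlt k
    · exact coeff_eq_zero_of_lt h0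
    · simp [h0]
  have hdeg (k) : ord.toSyn (ord.degree (h k * G k)) ≤ ord.toSyn L := by
    obtain h0 | h0 := hlt k
    · exact h0.le
    · rw [h0, degree_zero, map_zero]; exact ord.zero_le _
  have hmon (k : Fin m) (r : F) (hk : ord.degree (G k) ≤ L) :
      ord.toSyn (ord.degree (monomial (L - ord.degree (G k)) r * G k)) ≤ ord.toSyn L := by
    refine degree_mul_le.trans ?_
    rw [map_add]
    refine (add_le_add_left (degree_monomial_le r) _).trans ?_
    rw [← map_add, tsub_add_cancel_of_le hk]
  have hmc (k : Fin m) (r : F) (hk : ord.degree (G k) ≤ L) :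
      (monomial (L - ord.degree (G k)) r * G k).coeff L = r * ord.leadingCoeff (G k) := by
    have := coeff_monomial_mul (ord.degree (G k)) (L - ord.degree (G k)) r (G k)
    rwa [tsub_add_cancel_of_le hk] at this
  have hiL : ord.degree (G i) ≤ L := le_sup_left
  have hjL : ord.degree (G j) ≤ L := le_sup_right
  have hlcf {k : Fin m} (hk : G k ≠ 0) : ord.leadingCoeff (G k) ≠ 0 :=
    leadingCoeff_ne_zero_iff.mpr hk
  -- The cofactors defining the S-polynomial; the syzygy is `u - h`, and `h` contributes nothing at
  -- `L`.
  set u : Fin m → MvPolynomial (Fin n) F := fun k =>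
    if k = i then monomial (L - ord.degree (G i)) (ord.leadingCoeff (G j)) else
      if k = j then monomial (L - ord.degree (G j)) (-ord.leadingCoeff (G i)) else 0 with hu
  have hudeg (k) : ord.toSyn (ord.degree (u k * G k)) ≤ ord.toSyn L := by
    by_cases h1 : k = i
    · subst h1; simpa [hu] using hmon k _ hiL
    · by_cases h2 : k = j
      · subst h2; simpa [hu, h1] using hmon k (-ord.leadingCoeff (G i)) hjL
      · simp [hu, h1, h2]
  have hucoeff (k) : (u k * G k).coeff L ≠ 0 ↔ k = i ∨ k = j := by
    by_cases h1 : k = i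
    · subst h1; simp [hu, hmc k _ hiL, hlcf hi, hlcf hj]
    · by_cases h2 : k = j
      · subst h2
        simp only [hu, if_neg h1, if_true, hmc k _ hjL]
        simp [hlcf hi, hlcf hj]
      · simp [hu, h1, h2]
  have husum : ∑ k, u k * G k = ord.sPolynomial (G i) (G j) := by
    rw [Fintype.sum_eq_add i j hij fun k hk => by simp [hu, hk.1, hk.2], sPolynomial_def]
    simp only [hu, if_true, if_neg hij.symm, map_neg]
    ring
  refine ⟨fun k => u k - h k, ?_, fun k => ?_, fun k => ?_⟩
  · simp only [sub_mul, Finset.sum_sub_distrib]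
    rw [husum, hsum, sub_self]
  · rw [sub_mul]
    exact degree_sub_le.trans (sup_le (hudeg k) (hdeg k))
  · rw [sub_mul, coeff_sub, hcoeff k, sub_zero, hucoeff]

end SRepresentation

theorem mainTheorem3 {n m : ℕ} {F : Type*} [Field F] (ord : MonomialOrder (Fin n))
    (G : Fin (m + 1) → MvPolynomial (Fin n) F)
    (hG : ∀ i, G i ≠ 0)
    (hne : ord.degree (G 0) ≠ 0 ∨ ord.degree (G (Fin.last m)) ≠ 0)
    (hEC : ExtendedCriterion (fun i => ord.degree (G i)))
    (hS : ∀ i : Fin m, HasSRepresentation ord G i.castSucc i.succ) :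
    HasSRepresentation ord G 0 (Fin.last m) := by
  -- For a single polynomial, `S(g, g) = 0` and the term `1` lies below the nonconstant `lt(g)`.
  obtain rfl | hm := Nat.eq_zero_or_pos m
  · refine ⟨0, 0, ?_, by simp [IsTRepresentation, Fin.last_zero]⟩
    have h0 : ord.degree (G 0) ≠ 0 := hne.elim id id
    rw [Fin.last_zero, sup_idem, map_zero, ord.toSyn_lt_iff_ne_zero]
    simpa using h0
  have h0l : (0 : Fin (m + 1)) ≠ Fin.last m := by
    simpa [Fin.ext_iff] using hm.ne
  choose y hsum hdeg hcoeff using fun i : Fin m =>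
    (hS i).exists_syzygy ord (Fin.castSucc_lt_succ (i := i)).ne (hG _) (hG _)
  set L : Fin m → Fin n →₀ ℕ := fun i =>
    ord.degree (G i.castSucc) ⊔ ord.degree (G i.succ) with hL
  -- Scaling column `k` by `G k` gives each row a single degree bound `L i` and row sum zero.
  set M : Matrix (Fin m) (Fin (m + 1)) (MvPolynomial (Fin n) F) :=
    Matrix.of fun i k => y i k * G k with hM
  set D : Fin (m + 1) → MvPolynomial (Fin n) F := fun l =>
    (Matrix.of fun i k => y i (l.succAbove k)).det with hD
  have hMD (l : Fin (m + 1)) :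
      (M.submatrix id l.succAbove).det = (∏ k, G (l.succAbove k)) * D l := by
    rw [hD, ← Matrix.det_mul_row]
    congr 1
    ext1 i k
    simp [hM, mul_comm]
  have hminor (l : Fin (m + 1)) (hl : (Matrix.of fun i k =>
      (M i (l.succAbove k)).coeff (L i)).det ≠ 0) :
      D l ≠ 0 ∧ ord.degree (D l) + ∑ k, ord.degree (G (l.succAbove k)) = ∑ i, L i := by
    obtain ⟨hne, hdet⟩ := ord.degree_det_eq (M := M.submatrix id l.succAbove) (a := L)
      (fun i k => hdeg i _) hl
    rw [hMD] at hne hdet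
    have hDl := right_ne_zero_of_mul hne
    refine ⟨hDl, ?_⟩
    rw [← hdet, degree_mul (left_ne_zero_of_mul hne) hDl, degree_prod fun k _ => hG _, add_comm]
  -- Row `i` reaches `L i` only in columns `i` and `i + 1`. Deleting column `0` puts the latter on
  -- the diagonal; deleting the last column, the former.
  obtain ⟨hD0, hdeg0⟩ := hminor 0 (by
    rw [Matrix.det_of_isLowerTriangular _ fun i k hik => ?_, Finset.prod_ne_zero_iff]
    · exact fun i _ => (hcoeff i _).mpr (Or.inr rfl)
    · by_contra h
      have := (hcoeff i _).mp h
      simp [Fin.ext_iff] at this hik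
      omega)
  obtain ⟨hDl, hdegl⟩ := hminor (Fin.last m) (by
    rw [Matrix.det_of_isUpperTriangular fun i k hik => ?_, Finset.prod_ne_zero_iff]
    · exact fun i _ => (hcoeff i _).mpr (Or.inl (Fin.succAbove_last_apply i))
    · by_contra h
      have := (hcoeff i _).mp h
      simp [Fin.ext_iff] at this hik
      omega)
  have hrel : D 0 * G (Fin.last m) = D (Fin.last m) * G 0 ∨
      D 0 * G (Fin.last m) = -(D (Fin.last m) * G 0) := by
    -- Zero row sums make all maximal minors of `M` equal up to sign.
    have h := Matrix.submatrix_succAbove_det_eq_negOnePow_submatrix_succAbove_det' M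
      hsum 0 (Fin.last m)
    have hP : ∏ k, G k ≠ 0 := Finset.prod_ne_zero_iff.mpr fun k _ => hG k
    have hP0 := Fin.prod_univ_succAbove G 0
    have hPl := Fin.prod_univ_succAbove G (Fin.last m)
    rw [hMD, hMD, Units.smul_def] at h
    refine (Int.units_eq_one_or (((0 : Fin (m + 1)) : ℤ) - (Fin.last m : Fin (m + 1))).negOnePow).imp
      (fun hs => ?_) fun hs => ?_ <;> rw [hs] at h
    · refine mul_left_cancel₀ hP ?_
      rw [Units.val_one, one_smul] at h
      linear_combination G 0 * G (Fin.last m) * h + D 0 * G (Fin.last m) * hP0 -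
        D (Fin.last m) * G 0 * hPl
    · refine mul_left_cancel₀ hP ?_
      rw [Units.val_neg, Units.val_one, neg_smul, one_smul] at h
      linear_combination G 0 * G (Fin.last m) * h + D 0 * G (Fin.last m) * hP0 +
        D (Fin.last m) * G 0 * hPl
  obtain ⟨c, d, p, hcd, hc, hd⟩ :=
    UniqueFactorizationMonoid.exists_reduced_factors (G 0) (hG 0) (G (Fin.last m))
  have hp0 : p ≠ 0 := left_ne_zero_of_mul (hc ▸ hG 0)
  have hdvd : c ∣ D 0 ∧ d ∣ D (Fin.last m) := by
    have hrel' : D 0 * d = D (Fin.last m) * c ∨ D 0 * d = -(D (Fin.last m) * c) := by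
      refine hrel.imp (fun h => ?_) fun h => ?_ <;> refine mul_left_cancel₀ hp0 ?_ <;>
        rw [← hc, ← hd] at h <;> linear_combination h
    have hc' : c ∣ D 0 * d := by
      obtain h | h := hrel' <;> simp [h]
    have hd' : d ∣ D (Fin.last m) * c := by
      obtain h | h := hrel'
      · simp [← h]
      · simp [← dvd_neg (b := D (Fin.last m) * c), ← h]
    exact ⟨hcd.dvd_of_dvd_mul_right hc', hcd.symm.dvd_of_dvd_mul_right hd'⟩
  refine hasSRepresentation_of_inf_degree_eq_zero ord G h0l (hG _) (hG _) hne hc hd ?_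
  have hdivdeg {f g : MvPolynomial (Fin n) F} (hfg : f ∣ g) (hg : g ≠ 0) :
      ord.degree f ≤ ord.degree g := by
    obtain ⟨e, rfl⟩ := hfg
    rw [degree_mul' hg]
    exact le_self_add
  ext x
  change min (ord.degree c x) (ord.degree d x) = 0
  have h0x := DFunLike.congr_fun hdeg0 x
  have hlx := DFunLike.congr_fun hdegl x
  simp only [Finsupp.add_apply, Finsupp.finsetSum_apply, Fin.succAbove_zero,
    Fin.succAbove_last, hL, Finsupp.sup_apply] at h0x hlx
  have hcx := hdivdeg hdvd.1 hD0 x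
  have hdx := hdivdeg hdvd.2 hDl x
  obtain hx | hx | hx := hEC.evar x
  · have hx' : min (ord.degree (G 0) x) (ord.degree (G (Fin.last m)) x) = 0 := hx
    have h1 := hdivdeg (hc ▸ dvd_mul_left c p) (hG 0) x
    have h2 := hdivdeg (hd ▸ dvd_mul_left d p) (hG (Fin.last m)) x
    omega
  -- Nondecreasing: the maxima sum to the degrees of the `G i.succ`, so `D 0`, hence `c`, has
  -- leading term free of `x`. The nonincreasing case does the same for `d`.
  · have : ∀ i : Fin m, max (ord.degree (G i.castSucc) x) (ord.degree (G i.succ) x) =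
        ord.degree (G i.succ) x := fun i => max_eq_right (hx Fin.castSucc_lt_succ.le)
    simp only [this] at h0x
    omega
  · have : ∀ i : Fin m, max (ord.degree (G i.castSucc) x) (ord.degree (G i.succ) x) =
        ord.degree (G i.castSucc) x := fun i => max_eq_left (hx Fin.castSucc_lt_succ.le)
    simp only [this] at hlx
    omega
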